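/- Let $d\ge 1$ be an integer and $s\in(0,1]$. For $\xi\in\mathbb{R}^d$ put $\omega(\xi)=4\sum_{j=1}^d\sin^2(\xi_j/2)$, and for $t>0$ and $x\in\mathbb{Z}^d$ define the lattice fractional heat kernel $$G_t^{(s)}(x)=\frac{1}{(2\pi)^d}\int_{[-\pi,\pi]^d}e^{-t\,\omega(\xi)^s}\,e^{i\langle x,\xi\rangle}\,d\xi,\qquad \langle x,\xi\rangle=\sum_{j=1}^d x_j\xi_j .$$ Write $|y|=(y_1^2+\cdots+y_d^2)^{1/2}$ for $y\in\mathbb{Z}^d$. Then there exists a constant $C=C(d,s)>0$ such that for all $t>0$ and all $y\in\mathbb{Z}^d$ the series below converges and $$\sum_{x\in\mathbb{Z}^d}\bigl|G_t^{(s)}(x-y)-G_t^{(s)}(x)\bigr|\le C\,\min\bigl\{1,\ |y|\,t^{-1/(2s)}\bigr\}.$$ -/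

import Mathlib

noncomputable section

/-- The Fourier symbol of the (negative) discrete Laplacian on `ℤ^d`:
`ω(ξ) = 4 ∑_j sin² (ξ_j / 2)`. -/
def latticeSymbol {d : ℕ} (ξ : Fin d → ℝ) : ℝ :=
  4 * ∑ j, Real.sin (ξ j / 2) ^ 2

/-- The lattice fractional heat kernel on `ℤ^d`,
`G_t^{(s)}(x) = (2π)^{-d} ∫_{[-π,π]^d} exp (-t ω(ξ)^s) exp (i ⟨x, ξ⟩) dξ`,
written as the complex-valued Fourier integral, with Lebesgue measure on `[-π,π]^d`. -/
def latticeHeatKernel {d : ℕ} (s t : ℝ) (x : Fin d → ℤ) : ℂ :=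
  (1 / (2 * (Real.pi : ℂ)) ^ d) *
    ∫ ξ in Set.Icc (fun _ : Fin d => -Real.pi) (fun _ : Fin d => Real.pi),
      (Real.exp (-t * latticeSymbol ξ ^ s) : ℂ) *
        Complex.exp (Complex.I * ((∑ j, (x j : ℝ) * ξ j : ℝ) : ℂ))

/-- The Euclidean length `|y| = (y_1² + ⋯ + y_d²)^{1/2}` of a lattice point. -/
def latticeNorm {d : ℕ} (y : Fin d → ℤ) : ℝ :=
  Real.sqrt (∑ j, (y j : ℝ) ^ 2)

end

/-!
Up to normalization `1 - ω / (4 d)` is the symbol of a lazy random walk step: it is the average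
over `j` of `(1 + cos ξ_j) / 2`. Convolution with the kernel `(1/4, 1/2, 1/4)` in one coordinate
preserves the nonnegative functions that are even and unimodal in each coordinate. For
`0 < s ≤ 1` the power series of `1 - (1 - z) ^ s` has nonnegative coefficients, so
`1 - (ω / (4 d)) ^ s`, and after exponentiation `exp (-t ω ^ s)`, are nonnegative combinations of
powers of that symbol. Hence the heat kernel is nonnegative, has mass `1`, and is even and unimodal
in each coordinate.

For such a function the `ℓ¹` distance to its translate by a basis vector `e_j` telescopes along
lines to twice the mass of the hyperplane `x_j = 0`. By Fourier inversion this is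
`π⁻¹ ∫ exp (-t ω(θ e_j) ^ s) dθ` over `[-π, π]`, which Jordan's inequality bounds by
`Γ(1 / (2 s) + 1) t ^ (-1 / (2 s))`. Subadditivity in the translation then gives the general case.
-/

open Filter MeasureTheory Topology

section BinomialSeries

theorem hasSum_of_tendsto_powerSeries {κ : Type*} {a : κ → ℝ} (ha : ∀ i, 0 ≤ a i) (k : κ → ℕ)
    {f : ℝ → ℝ} {l : ℝ} (hf : ∀ᶠ z in 𝓝[<] 1, HasSum (fun i => a i * z ^ k i) (f z))
    (hl : Tendsto f (𝓝[<] 1) (𝓝 l)) : HasSum a l := by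
  have hIoo : ∀ᶠ z : ℝ in 𝓝[<] 1, z ∈ Set.Ioo 0 1 := Ioo_mem_nhdsLT one_pos
  refine hasSum_of_isLUB_of_nonneg l ha ⟨?_, fun b hb => ?_⟩
  · rintro _ ⟨S, rfl⟩
    have hS : Tendsto (fun z : ℝ => ∑ i ∈ S, a i * z ^ k i) (𝓝[<] 1) (𝓝 (∑ i ∈ S, a i)) := by
      have hcont : Continuous fun z : ℝ => ∑ i ∈ S, a i * z ^ k i := by fun_prop
      simpa using (hcont.tendsto 1).mono_left nhdsWithin_le_nhds
    refine le_of_tendsto_of_tendsto hS hl ?_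
    filter_upwards [hf, hIoo] with z hsum hz
    exact sum_le_hasSum _ (fun i _ => mul_nonneg (ha i) (pow_nonneg hz.1.le _)) hsum
  · refine le_of_tendsto hl ?_
    filter_upwards [hf, hIoo] with z hsum hz
    refine hasSum_le_of_sum_le hsum fun S => (Finset.sum_le_sum fun i _ => ?_).trans (hb ⟨S, rfl⟩)
    exact mul_le_of_le_one_right (ha i) (pow_le_one₀ hz.1.le hz.2.le)

theorem hasSum_multichoose_mul_pow (a : ℝ) {z : ℝ} (hz : |z| < 1) :
    HasSum (fun n => Ring.multichoose a n * z ^ n) ((1 - z) ^ (-a)) := by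
  have hmem : z ∈ Metric.eball (0 : ℝ) 1 := by simpa [edist_dist] using hz
  have h := (Real.one_div_one_sub_rpow_hasFPowerSeriesOnBall_zero a).hasSum hmem
  simp only [zero_add, FormalMultilinearSeries.ofScalars_apply_eq, smul_eq_mul,
    ← Ring.multichoose_eq] at h
  rwa [Real.rpow_neg (by linarith [lt_of_abs_lt hz]), ← one_div]

variable {s : ℝ}

theorem multichoose_neg_succ_nonpos (hs₀ : 0 ≤ s) (hs₁ : s ≤ 1) (n : ℕ) :
    Ring.multichoose (-s) (n + 1) ≤ 0 := by
  have hpoch : (ascPochhammer ℝ (n + 1)).eval (-s) ≤ 0 := by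
    induction n with
    | zero => simpa using hs₀
    | succ n ih =>
      rw [ascPochhammer_succ_eval]
      refine mul_nonpos_of_nonpos_of_nonneg ih ?_
      push_cast
      linarith [n.cast_nonneg (α := ℝ)]
  rw [← Polynomial.ascPochhammer_smeval_eq_eval,
    ← Ring.factorial_nsmul_multichoose_eq_ascPochhammer, nsmul_eq_mul] at hpoch
  exact nonpos_of_mul_nonpos_right hpoch (by positivity)

theorem hasSum_neg_multichoose_mul_pow (hs₀ : 0 < s) (hs₁ : s ≤ 1) {z : ℝ} (hz₀ : 0 ≤ z)
    (hz₁ : z ≤ 1) :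
    HasSum (fun n => -Ring.multichoose (-s) (n + 1) * z ^ (n + 1)) (1 - (1 - z) ^ s) := by
  have hlt : ∀ w ∈ Set.Ico (0 : ℝ) 1,
      HasSum (fun n => -Ring.multichoose (-s) (n + 1) * w ^ (n + 1)) (1 - (1 - w) ^ s) := by
    intro w hw
    have h := hasSum_multichoose_mul_pow (-s) (abs_lt.2 ⟨by linarith [hw.1], hw.2⟩)
    rw [← hasSum_nat_add_iff' 1] at h
    simpa using h.neg
  rcases hz₁.lt_or_eq with hz | rfl
  · exact hlt z ⟨hz₀, hz⟩
  have hcont : Continuous fun w : ℝ => 1 - (1 - w) ^ s :=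
    continuous_const.sub ((continuous_const.sub continuous_id).rpow_const fun _ => .inr hs₀.le)
  simpa using hasSum_of_tendsto_powerSeries
    (fun n => neg_nonneg.2 (multichoose_neg_succ_nonpos hs₀.le hs₁ n)) (· + 1)
    (eventually_of_mem (Ico_mem_nhdsLT one_pos) hlt)
    ((hcont.tendsto 1).mono_left nhdsWithin_le_nhds)

end BinomialSeries

section TranslationDist

variable {G E : Type*} [SeminormedAddCommGroup E]

/-- The `ℓ¹` distance between a function on a group and its translate by `y`. It is `0` by the
convention on `∑'` when the series diverges. -/
noncomputable def translationDist [Sub G] (g : G → E) (y : G) : ℝ := ∑' x, ‖g (x - y) - g x‖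

theorem summable_norm_comp_sub [AddGroup G] {g : G → E} (hg : Summable fun x => ‖g x‖) (y : G) :
    Summable fun x => ‖g (x - y)‖ :=
  hg.comp_injective (sub_left_injective (b := y))

theorem summable_norm_translate_sub [AddGroup G] {g : G → E} (hg : Summable fun x => ‖g x‖)
    (y : G) : Summable fun x => ‖g (x - y) - g x‖ :=
  .of_nonneg_of_le (fun _ => norm_nonneg _) (fun _ => norm_sub_le _ _)
    ((summable_norm_comp_sub hg y).add hg)

theorem translationDist_zero [AddGroup G] (g : G → E) : translationDist g 0 = 0 := by
  simp [translationDist]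

theorem translationDist_neg [AddGroup G] (g : G → E) (y : G) :
    translationDist g (-y) = translationDist g y := by
  rw [translationDist, ← (Equiv.subRight y).tsum_eq, translationDist]
  simp [norm_sub_rev]

theorem translationDist_le_two_mul_tsum_norm [AddGroup G] {g : G → E}
    (hg : Summable fun x => ‖g x‖) (y : G) : translationDist g y ≤ 2 * ∑' x, ‖g x‖ := by
  have hy := summable_norm_comp_sub hg y
  have htranslate : ∑' x, ‖g (x - y)‖ = ∑' x, ‖g x‖ :=
    (Equiv.subRight y).tsum_eq fun x => ‖g x‖
  calc translationDist g y ≤ ∑' x, (‖g (x - y)‖ + ‖g x‖) :=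
        (summable_norm_translate_sub hg y).tsum_le_tsum (fun _ => norm_sub_le _ _) (hy.add hg)
    _ = 2 * ∑' x, ‖g x‖ := by rw [hy.tsum_add hg, htranslate, two_mul]

theorem translationDist_add_le [AddGroup G] {g : G → E} (hg : Summable fun x => ‖g x‖)
    (y z : G) : translationDist g (y + z) ≤ translationDist g y + translationDist g z := by
  have hy : Summable fun x => ‖g (x - z - y) - g (x - z)‖ :=
    (summable_norm_translate_sub hg y).comp_injective (sub_left_injective (b := z))
  have hz := summable_norm_translate_sub hg z
  have htranslate : ∑' x, ‖g (x - z - y) - g (x - z)‖ = translationDist g y :=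
    (Equiv.subRight z).tsum_eq fun x => ‖g (x - y) - g x‖
  calc translationDist g (y + z)
      ≤ ∑' x, (‖g (x - z - y) - g (x - z)‖ + ‖g (x - z) - g x‖) := by
        refine (summable_norm_translate_sub hg _).tsum_le_tsum (fun x => ?_) (hy.add hz)
        rw [sub_add_eq_sub_sub_swap]
        exact norm_sub_le_norm_sub_add_norm_sub _ _ _
    _ = translationDist g y + translationDist g z := by
        rw [hy.tsum_add hz, htranslate, translationDist.eq_1 g z]

theorem translationDist_nsmul_le [AddGroup G] {g : G → E} (hg : Summable fun x => ‖g x‖)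
    (n : ℕ) (y : G) : translationDist g (n • y) ≤ n * translationDist g y := by
  induction n with
  | zero => simp [translationDist_zero]
  | succ n ih =>
    rw [succ_nsmul]
    push_cast
    linarith [translationDist_add_le hg (n • y) y]

theorem translationDist_zsmul_le [AddGroup G] {g : G → E} (hg : Summable fun x => ‖g x‖)
    (n : ℤ) (y : G) : translationDist g (n • y) ≤ |(n : ℝ)| * translationDist g y := by
  obtain ⟨m, rfl | rfl⟩ := n.eq_nat_or_neg
  · simpa using translationDist_nsmul_le hg m y
  · simpa [translationDist_neg] using translationDist_nsmul_le hg m y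

theorem translationDist_le_sum_abs_mul {ι : Type*} [Fintype ι] [DecidableEq ι]
    {g : (ι → ℤ) → E} (hg : Summable fun x => ‖g x‖) {B : ℝ}
    (hB : ∀ j, translationDist g (Pi.single j 1) ≤ B) (y : ι → ℤ) :
    translationDist g y ≤ (∑ j, |(y j : ℝ)|) * B := by
  have hy : y = ∑ j, y j • (Pi.single j 1 : ι → ℤ) := by
    ext i
    simp [Finset.sum_apply, Pi.single_apply]
  calc translationDist g y = translationDist g (∑ j, y j • (Pi.single j 1 : ι → ℤ)) := by rw [← hy]
    _ ≤ ∑ j, translationDist g (y j • (Pi.single j 1 : ι → ℤ)) :=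
        Finset.le_sum_of_subadditive _ (translationDist_zero g).le (translationDist_add_le hg) _ _
    _ ≤ ∑ j, |(y j : ℝ)| * B := Finset.sum_le_sum fun j _ =>
        (translationDist_zsmul_le hg _ _).trans (mul_le_mul_of_nonneg_left (hB j) (abs_nonneg _))
    _ = (∑ j, |(y j : ℝ)|) * B := (Finset.sum_mul ..).symm

end TranslationDist

/-- Nonnegative functions on `ℤ^ι` that are even and unimodal in each coordinate, encoded as
antitonicity in the vector of absolute values of the coordinates. -/
structure IsSymmUnimodal {ι : Type*} (g : (ι → ℤ) → ℝ) : Prop where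
  nonneg : ∀ x, 0 ≤ g x
  anti : ∀ ⦃x y⦄, |x| ≤ |y| → g y ≤ g x

namespace IsSymmUnimodal

variable {ι : Type*} {g : (ι → ℤ) → ℝ}

theorem const_mul (hg : IsSymmUnimodal g) {c : ℝ} (hc : 0 ≤ c) :
    IsSymmUnimodal fun x => c * g x where
  nonneg x := mul_nonneg hc (hg.nonneg x)
  anti _ _ hxy := mul_le_mul_of_nonneg_left (hg.anti hxy) hc

theorem tsum {κ : Type*} {g : κ → (ι → ℤ) → ℝ} (hg : ∀ k, IsSymmUnimodal (g k))
    (hs : ∀ x, Summable fun k => g k x) : IsSymmUnimodal fun x => ∑' k, g k x where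
  nonneg x := tsum_nonneg fun k => (hg k).nonneg x
  anti x y hxy := (hs y).tsum_le_tsum (fun k => (hg k).anti hxy) (hs x)

theorem ite_eq_zero [Fintype ι] :
    IsSymmUnimodal fun x : ι → ℤ => if x = 0 then (1 : ℝ) else 0 where
  nonneg x := by positivity
  anti x y hxy := by
    have hx (hy : y = 0) : x = 0 := funext fun i => abs_nonpos_iff.1 (by simpa [hy] using hxy i)
    split_ifs <;> first | positivity | tauto

variable [DecidableEq ι]

theorem add_single_le (hg : IsSymmUnimodal g) {x y : ι → ℤ} (hxy : |x| ≤ |y|) {j : ι} {a b : ℤ}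
    (hj : |x j + a| ≤ |y j + b|) : g (y + Pi.single j b) ≤ g (x + Pi.single j a) := by
  refine hg.anti fun i => ?_
  rcases eq_or_ne i j with rfl | hij
  · simpa using hj
  · simpa [hij] using hxy i

theorem lazyStep (hg : IsSymmUnimodal g) (j : ι) :
    IsSymmUnimodal fun x =>
      g x / 2 + (g (x + Pi.single j 1) + g (x + Pi.single j (-1))) / 4 where
  nonneg x := by
    linarith [hg.nonneg x, hg.nonneg (x + Pi.single j 1), hg.nonneg (x + Pi.single j (-1))]
  anti x y hxy := by
    have hj : |x j| ≤ |y j| := hxy j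
    have hle (a b : ℤ) (hab : |x j + a| ≤ |y j + b|) :
        g (y + Pi.single j b) ≤ g (x + Pi.single j a) := hg.add_single_le hxy hab
    have hx₀ : g (x + Pi.single j 0) = g x := by simp
    have hy₀ : g (y + Pi.single j 0) = g y := by simp
    rcases hj.lt_or_eq with hlt | heq
    · have h₁ := hle 1 0 (by grind)
      have h₂ := hle (-1) 0 (by grind)
      linarith [hle 0 (-1) (by grind), hle 0 1 (by grind)]
    · have h₀ := hle 0 0 (by grind)
      rcases abs_eq_abs.1 heq with h | h
      · linarith [hle 1 1 (by grind), hle (-1) (-1) (by grind)]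
      · linarith [hle 1 (-1) (by grind), hle (-1) 1 (by grind)]

theorem translationDist_single (hg : IsSymmUnimodal g) (hs : Summable g) (j : ι) {M : ℝ}
    (hM : HasSum (fun x => if x j = 0 then g x else 0) M) :
    translationDist g (Pi.single j 1) = 2 * M := by
  -- Each line in direction `j` telescopes away from the hyperplane `x j = 0`.
  let h : (ι → ℤ) → ℝ := fun x => if 0 ≤ x j then g x else -g x
  have hh : Summable h := .of_norm_bounded hs fun x => by
    unfold h
    split_ifs <;> simp [abs_of_nonneg (hg.nonneg x)]
  have htelescope : HasSum (fun x => h (x - Pi.single j 1) - h x) 0 := by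
    simpa using ((Equiv.subRight (Pi.single j (1 : ℤ))).hasSum_iff.2 hh.hasSum).sub hh.hasSum
  have hpoint (x : ι → ℤ) : |g (x - Pi.single j 1) - g x| =
      h (x - Pi.single j 1) - h x + 2 * if x j = 0 then g x else 0 := by
    have hle (a b : ℤ) (hab : |x j + a| ≤ |x j + b|) := hg.add_single_le le_rfl hab
    simp only [h, Pi.sub_apply, Pi.single_eq_same]
    rcases le_or_gt 1 (x j) with hx | hx
    · have hmono : g x ≤ g (x - Pi.single j 1) := by
        simpa [sub_eq_add_neg, Pi.single_neg] using hle (-1) 0 (by grind)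
      rw [abs_of_nonneg (sub_nonneg.2 hmono)]
      grind
    · have hmono : g (x - Pi.single j 1) ≤ g x := by
        simpa [sub_eq_add_neg, Pi.single_neg] using hle 0 (-1) (by grind)
      rw [abs_of_nonpos (sub_nonpos.2 hmono)]
      grind
  simp only [translationDist, Real.norm_eq_abs, hpoint]
  rw [(htelescope.add (hM.mul_left 2)).tsum_eq, zero_add]

end IsSymmUnimodal

section LatticeFourier

variable {ι : Type*} [Fintype ι]

/-- The character `ξ ↦ exp (i ⟨x, ξ⟩)` attached to a lattice point `x`. -/
noncomputable def latticeChar (x : ι → ℤ) (ξ : ι → ℝ) : ℂ :=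
  Complex.exp (Complex.I * ((∑ j, (x j : ℝ) * ξ j : ℝ) : ℂ))

theorem latticeChar_eq_prod (x : ι → ℤ) (ξ : ι → ℝ) :
    latticeChar x ξ = ∏ j, Complex.exp (((x j * ξ j : ℝ) : ℂ) * Complex.I) := by
  rw [latticeChar, ← Complex.exp_sum, ← Finset.sum_mul, mul_comm, Complex.ofReal_sum]

theorem latticeChar_add (x y : ι → ℤ) (ξ : ι → ℝ) :
    latticeChar (x + y) ξ = latticeChar x ξ * latticeChar y ξ := by
  simp only [latticeChar, ← Complex.exp_add, ← mul_add, ← Complex.ofReal_add,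
    ← Finset.sum_add_distrib, ← add_mul, Pi.add_apply, Int.cast_add]

@[simp] theorem norm_latticeChar (x : ι → ℤ) (ξ : ι → ℝ) : ‖latticeChar x ξ‖ = 1 := by
  rw [latticeChar, mul_comm, Complex.norm_exp_ofReal_mul_I]

@[simp] theorem latticeChar_zero_left (ξ : ι → ℝ) : latticeChar (0 : ι → ℤ) ξ = 1 := by
  simp [latticeChar]

@[simp] theorem latticeChar_zero_right (x : ι → ℤ) : latticeChar x 0 = 1 := by
  simp [latticeChar]

theorem latticeChar_single_left [DecidableEq ι] (j : ι) (n : ℤ) (ξ : ι → ℝ) :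
    latticeChar (Pi.single j n) ξ = Complex.exp (((n * ξ j : ℝ) : ℂ) * Complex.I) := by
  rw [latticeChar, Fintype.sum_eq_single j fun i hi => by simp [hi], Pi.single_eq_same, mul_comm]

theorem latticeChar_single_right [DecidableEq ι] (x : ι → ℤ) (j : ι) (θ : ℝ) :
    latticeChar x (Pi.single j θ) = Complex.exp (((x j * θ : ℝ) : ℂ) * Complex.I) := by
  rw [latticeChar, Fintype.sum_eq_single j fun i hi => by simp [hi], Pi.single_eq_same, mul_comm]

@[fun_prop]
theorem continuous_latticeChar (x : ι → ℤ) : Continuous (latticeChar x) := by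
  unfold latticeChar
  fun_prop

theorem setIntegral_exp_int_mul_I (n : ℤ) :
    ∫ θ in Set.Icc (-Real.pi) Real.pi, Complex.exp (((n * θ : ℝ) : ℂ) * Complex.I) =
      if n = 0 then 2 * (Real.pi : ℂ) else 0 := by
  rw [integral_Icc_eq_integral_Ioc, ← intervalIntegral.integral_of_le (by linarith [Real.pi_pos])]
  split_ifs with hn
  · simp [hn, two_mul]
  · have hc : (n : ℂ) * Complex.I ≠ 0 := mul_ne_zero (Int.cast_ne_zero.2 hn) Complex.I_ne_zero
    have hcomm (θ : ℝ) : ((n * θ : ℝ) : ℂ) * Complex.I = n * Complex.I * θ := by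
      push_cast
      ring
    simp only [hcomm]
    rw [integral_exp_mul_complex hc, div_eq_zero_iff, sub_eq_zero,
      Complex.exp_eq_exp_iff_exists_int]
    exact .inl ⟨n, by push_cast; ring⟩

theorem setIntegral_latticeChar (x : ι → ℤ) :
    ∫ ξ in Set.Icc (fun _ : ι => -Real.pi) (fun _ : ι => Real.pi), latticeChar x ξ =
      if x = 0 then (2 * (Real.pi : ℂ)) ^ Fintype.card ι else 0 := by
  rw [← Set.pi_univ_Icc, volume_pi, Measure.restrict_pi_pi]
  simp only [latticeChar_eq_prod]
  rw [integral_fintype_prod_eq_prod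
    (fun j (θ : ℝ) => Complex.exp (((x j * θ : ℝ) : ℂ) * Complex.I))]
  simp only [setIntegral_exp_int_mul_I]
  split_ifs with hx
  · simp [hx]
  · obtain ⟨j, hj⟩ := Function.ne_iff.1 hx
    exact Finset.prod_eq_zero (Finset.mem_univ j) (if_neg hj)

/-- `g` is absolutely summable on `ℤ^ι` and `f` is the sum of its Fourier series
`∑ x, g x * exp (-i ⟨x, ξ⟩)`. -/
structure IsLatticeFourierPair (g : (ι → ℤ) → ℂ) (f : (ι → ℝ) → ℂ) : Prop where
  summable : Summable g
  hasSum : ∀ ξ, HasSum (fun x => g x * latticeChar (-x) ξ) (f ξ)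

namespace IsLatticeFourierPair

variable {g g₁ g₂ : (ι → ℤ) → ℂ} {f f₁ f₂ : (ι → ℝ) → ℂ}

theorem hasSum_apply_zero (h : IsLatticeFourierPair g f) : HasSum g (f 0) := by
  simpa using h.hasSum 0

theorem ite_eq_zero :
    IsLatticeFourierPair (fun x : ι → ℤ => if x = 0 then 1 else 0) fun _ => 1 where
  summable := (hasSum_ite_eq 0 1).summable
  hasSum ξ := by
    convert hasSum_ite_eq (0 : ι → ℤ) (1 : ℂ) using 2 with x
    split_ifs with h <;> simp [h]

theorem const_mul (h : IsLatticeFourierPair g f) (c : ℂ) :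
    IsLatticeFourierPair (fun x => c * g x) fun ξ => c * f ξ where
  summable := h.summable.mul_left c
  hasSum ξ := by simpa only [mul_assoc] using (h.hasSum ξ).mul_left c

theorem add (h₁ : IsLatticeFourierPair g₁ f₁) (h₂ : IsLatticeFourierPair g₂ f₂) :
    IsLatticeFourierPair (fun x => g₁ x + g₂ x) fun ξ => f₁ ξ + f₂ ξ where
  summable := h₁.summable.add h₂.summable
  hasSum ξ := by simpa only [add_mul] using (h₁.hasSum ξ).add (h₂.hasSum ξ)

theorem comp_add_right (h : IsLatticeFourierPair g f) (y : ι → ℤ) :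
    IsLatticeFourierPair (fun x => g (x + y)) fun ξ => latticeChar y ξ * f ξ where
  summable := (Equiv.addRight y).summable_iff.2 h.summable
  hasSum ξ := by
    convert! ((Equiv.addRight y).hasSum_iff.2 (h.hasSum ξ)).mul_left (latticeChar y ξ) using 2
      with x
    simp only [Function.comp_apply, Equiv.coe_addRight]
    rw [mul_left_comm, ← latticeChar_add]
    congr 2
    abel

theorem tsum {κ : Type*} {G : κ → (ι → ℤ) → ℂ} {F : κ → (ι → ℝ) → ℂ}
    (h : ∀ k, IsLatticeFourierPair (G k) (F k))
    (hG : Summable fun p : κ × (ι → ℤ) => G p.1 p.2) :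
    IsLatticeFourierPair (fun x => ∑' k, G k x) fun ξ => ∑' k, F k ξ where
  summable := hG.prod_symm.prod
  hasSum ξ := by
    have hchar : Summable fun p : κ × (ι → ℤ) => G p.1 p.2 * latticeChar (-p.2) ξ :=
      .of_norm_bounded hG.norm fun p => by simp
    have hcomm : ∑' x, ∑' k, G k x * latticeChar (-x) ξ = ∑' k, F k ξ := by
      simpa only [((h _).hasSum ξ).tsum_eq] using
        Summable.tsum_comm (f := fun k x => G k x * latticeChar (-x) ξ) hchar
    simp only [← hcomm, ← tsum_mul_right]
    exact hchar.prod_symm.prod.hasSum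

theorem continuous (h : IsLatticeFourierPair g f) : Continuous f := by
  have hf : f = fun ξ => ∑' x, g x * latticeChar (-x) ξ :=
    funext fun ξ => (h.hasSum ξ).tsum_eq.symm
  rw [hf]
  exact continuous_tsum (fun x => by fun_prop) h.summable.norm fun x ξ => by simp

theorem hasSum_integral (h : IsLatticeFourierPair g f) (μ : Measure (ι → ℝ)) [IsFiniteMeasure μ]
    (x : ι → ℤ) :
    HasSum (fun y => g y * ∫ ξ, latticeChar (x - y) ξ ∂μ) (∫ ξ, f ξ * latticeChar x ξ ∂μ) := by
  have hint (y : ι → ℤ) : Integrable (fun ξ => g y * latticeChar (x - y) ξ) μ :=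
    .of_bound (by fun_prop) ‖g y‖ (.of_forall fun ξ => by simp)
  have hnorm : Summable fun y => ∫ ξ, ‖g y * latticeChar (x - y) ξ‖ ∂μ := by
    simpa using h.summable.norm.mul_left (μ.real Set.univ)
  have hseries (ξ : ι → ℝ) : ∑' y, g y * latticeChar (x - y) ξ = f ξ * latticeChar x ξ := by
    rw [← ((h.hasSum ξ).mul_right (latticeChar x ξ)).tsum_eq]
    simp only [mul_assoc, ← latticeChar_add, neg_add_eq_sub]
  simpa only [integral_const_mul, hseries] using
    hasSum_integral_of_summable_integral_norm hint hnorm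

theorem setIntegral_eq (h : IsLatticeFourierPair g f) (x : ι → ℤ) :
    1 / (2 * (Real.pi : ℂ)) ^ Fintype.card ι *
      ∫ ξ in Set.Icc (fun _ : ι => -Real.pi) (fun _ : ι => Real.pi), f ξ * latticeChar x ξ =
        g x := by
  have : IsFiniteMeasure (volume.restrict
      (Set.Icc (fun _ : ι => -Real.pi) (fun _ : ι => Real.pi))) :=
    isFiniteMeasure_restrict.2 isCompact_Icc.measure_lt_top.ne
  have hs := h.hasSum_integral (volume.restrict
    (Set.Icc (fun _ : ι => -Real.pi) (fun _ : ι => Real.pi))) x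
  simp only [setIntegral_latticeChar] at hs
  rw [hs.unique (hasSum_single x fun y hy => by rw [if_neg (sub_ne_zero.2 hy.symm), mul_zero]),
    sub_self, if_pos rfl]
  field_simp [Complex.ofReal_ne_zero.2 Real.pi_ne_zero]

theorem hasSum_hyperplane [DecidableEq ι] (h : IsLatticeFourierPair g f) (j : ι) :
    HasSum (fun x => if x j = 0 then g x else 0)
      (1 / (2 * (Real.pi : ℂ)) * ∫ θ in Set.Icc (-Real.pi) Real.pi, f (Pi.single j θ)) := by
  have hline : Continuous fun θ : ℝ => (Pi.single j θ : ι → ℝ) :=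
    continuous_single (A := fun _ : ι => ℝ) j
  have : IsFiniteMeasure (volume.restrict (Set.Icc (-Real.pi) Real.pi)) :=
    isFiniteMeasure_restrict.2 isCompact_Icc.measure_lt_top.ne
  have hs := h.hasSum_integral
    ((volume.restrict (Set.Icc (-Real.pi) Real.pi)).map fun θ : ℝ => Pi.single j θ) 0
  simp only [latticeChar_zero_left, mul_one,
    integral_map hline.aemeasurable h.continuous.aestronglyMeasurable,
    integral_map hline.aemeasurable (continuous_latticeChar _).aestronglyMeasurable,
    latticeChar_single_right, setIntegral_exp_int_mul_I, zero_sub, Pi.neg_apply, neg_eq_zero] at hs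
  convert! hs.mul_left (1 / (2 * (Real.pi : ℂ))) using 2 with x
  split_ifs
  · field_simp [Complex.ofReal_ne_zero.2 Real.pi_ne_zero]
  · simp

end IsLatticeFourierPair

end LatticeFourier

section UnimodalMultiplier

variable {ι : Type*} [Fintype ι]

/-- `f` is the Fourier series of a summable symmetric unimodal function on `ℤ^ι`. -/
def IsUnimodalSymbol (f : (ι → ℝ) → ℝ) : Prop :=
  ∃ g : (ι → ℤ) → ℝ, IsSymmUnimodal g ∧
    IsLatticeFourierPair (fun x => (g x : ℂ)) fun ξ => (f ξ : ℂ)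

namespace IsUnimodalSymbol

theorem one : IsUnimodalSymbol fun _ : ι → ℝ => 1 := by
  refine ⟨_, .ite_eq_zero, ?_⟩
  simpa [apply_ite] using IsLatticeFourierPair.ite_eq_zero (ι := ι)

theorem const_mul {f : (ι → ℝ) → ℝ} (hf : IsUnimodalSymbol f) {c : ℝ} (hc : 0 ≤ c) :
    IsUnimodalSymbol fun ξ => c * f ξ := by
  obtain ⟨g, hg, hgf⟩ := hf
  exact ⟨_, hg.const_mul hc, by simpa using hgf.const_mul (c : ℂ)⟩

theorem of_hasSum {κ : Type*} {F : κ → (ι → ℝ) → ℝ} {f : (ι → ℝ) → ℝ}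
    (hF : ∀ k, IsUnimodalSymbol (F k)) (hf : ∀ ξ, HasSum (fun k => F k ξ) (f ξ)) :
    IsUnimodalSymbol f := by
  choose G hG hGF using hF
  have hmass (k : κ) : HasSum (G k) (F k 0) := Complex.hasSum_ofReal.1 (hGF k).hasSum_apply_zero
  have hprod : Summable fun p : κ × (ι → ℤ) => G p.1 p.2 := by
    refine (summable_prod_of_nonneg fun p => (hG p.1).nonneg p.2).2
      ⟨fun k => (hmass k).summable, ?_⟩
    simpa only [(hmass _).tsum_eq] using (hf 0).summable
  refine ⟨fun x => ∑' k, G k x, .tsum hG hprod.prod_symm.prod_factor, ?_⟩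
  simpa only [Complex.ofReal_tsum, ← (hf _).tsum_eq] using
    IsLatticeFourierPair.tsum hGF (Complex.summable_ofReal.2 hprod)

end IsUnimodalSymbol

/-- Multiplication by `m` preserves Fourier series of summable symmetric unimodal functions; in
physical space this is convolution with a kernel that respects symmetric unimodality. -/
def IsUnimodalMultiplier (m : (ι → ℝ) → ℝ) : Prop :=
  ∀ ⦃f : (ι → ℝ) → ℝ⦄, IsUnimodalSymbol f → IsUnimodalSymbol fun ξ => m ξ * f ξ

namespace IsUnimodalMultiplier

variable {m : (ι → ℝ) → ℝ}

theorem isUnimodalSymbol (hm : IsUnimodalMultiplier m) : IsUnimodalSymbol m := by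
  simpa using hm .one

theorem pow (hm : IsUnimodalMultiplier m) (n : ℕ) : IsUnimodalMultiplier fun ξ => m ξ ^ n := by
  intro f hf
  induction n with
  | zero => simpa using hf
  | succ n ih => simpa only [pow_succ', mul_assoc] using hm ih

theorem of_hasSum {κ : Type*} {a : κ → ℝ} (ha : ∀ k, 0 ≤ a k) {M : κ → (ι → ℝ) → ℝ}
    (hM : ∀ k, IsUnimodalMultiplier (M k)) (hm : ∀ ξ, HasSum (fun k => a k * M k ξ) (m ξ)) :
    IsUnimodalMultiplier m := fun f hf =>
  .of_hasSum (fun k => (hM k hf).const_mul (ha k)) fun ξ => by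
    simpa only [mul_assoc] using (hm ξ).mul_right (f ξ)

theorem lazyStep (j : ι) : IsUnimodalMultiplier fun ξ => (1 + Real.cos (ξ j)) / 2 := by
  classical
  rintro f ⟨g, hg, hgf⟩
  refine ⟨_, hg.lazyStep j, ?_⟩
  have h := (hgf.const_mul (1 / 2)).add (((hgf.comp_add_right (Pi.single j 1)).add
    (hgf.comp_add_right (Pi.single j (-1)))).const_mul (1 / 4))
  convert! h using 2 with x ξ
  · push_cast
    ring
  · rw [← add_mul, latticeChar_single_left, latticeChar_single_left, Complex.ofReal_mul,
      Complex.ofReal_div, Complex.ofReal_add, Complex.ofReal_cos, Complex.cos]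
    push_cast
    ring_nf

end IsUnimodalMultiplier

end UnimodalMultiplier

section LatticeSymbol

variable {d : ℕ}

theorem latticeSymbol_eq_sum_cos (ξ : Fin d → ℝ) :
    latticeSymbol ξ = ∑ j, 2 * (1 - Real.cos (ξ j)) := by
  rw [latticeSymbol, Finset.mul_sum]
  refine Finset.sum_congr rfl fun j _ => ?_
  rw [Real.sin_sq_eq_half_sub, mul_div_cancel₀ _ two_ne_zero]
  ring

theorem latticeSymbol_single (j : Fin d) (θ : ℝ) :
    latticeSymbol (Pi.single j θ) = |2 * Real.sin (θ / 2)| ^ (2 : ℝ) := by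
  rw [latticeSymbol, Fintype.sum_eq_single j fun i hi => by simp [hi], Pi.single_eq_same,
    Real.rpow_two, sq_abs]
  ring

theorem latticeSymbol_zero : latticeSymbol (0 : Fin d → ℝ) = 0 := by
  simp [latticeSymbol]

theorem latticeSymbol_nonneg (ξ : Fin d → ℝ) : 0 ≤ latticeSymbol ξ := by
  unfold latticeSymbol
  positivity

theorem latticeSymbol_le (ξ : Fin d → ℝ) : latticeSymbol ξ ≤ 4 * d := by
  have hsum : ∑ j, Real.sin (ξ j / 2) ^ 2 ≤ d := by
    simpa using Finset.sum_le_card_nsmul Finset.univ _ 1 fun j _ => Real.sin_sq_le_one (ξ j / 2)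
  unfold latticeSymbol
  gcongr

theorem isUnimodalMultiplier_one_sub_latticeSymbol (hd : 1 ≤ d) :
    IsUnimodalMultiplier fun ξ : Fin d → ℝ => 1 - latticeSymbol ξ / (4 * d) := by
  refine .of_hasSum (a := fun _ => 1 / (d : ℝ)) (fun _ => by positivity) .lazyStep fun ξ => ?_
  convert hasSum_fintype fun j : Fin d => 1 / (d : ℝ) * ((1 + Real.cos (ξ j)) / 2) using 1
  rw [latticeSymbol_eq_sum_cos, ← Finset.mul_sum, ← Finset.mul_sum, ← Finset.sum_div,
    Finset.sum_sub_distrib, Finset.sum_add_distrib]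
  simp only [Finset.sum_const, Finset.card_univ, Fintype.card_fin, nsmul_eq_mul, mul_one]
  field_simp
  ring

variable {s : ℝ}

theorem isUnimodalMultiplier_one_sub_latticeSymbol_rpow (hd : 1 ≤ d) (hs₀ : 0 < s) (hs₁ : s ≤ 1) :
    IsUnimodalMultiplier fun ξ : Fin d → ℝ => 1 - (latticeSymbol ξ / (4 * d)) ^ s := by
  refine .of_hasSum (fun n => neg_nonneg.2 (multichoose_neg_succ_nonpos hs₀.le hs₁ n))
    (fun n => (isUnimodalMultiplier_one_sub_latticeSymbol hd).pow (n + 1)) fun ξ => ?_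
  have h₀ : 0 ≤ latticeSymbol ξ / (4 * d) := div_nonneg (latticeSymbol_nonneg ξ) (by positivity)
  have h₁ : latticeSymbol ξ / (4 * d) ≤ 1 := (div_le_one (by positivity)).2 (latticeSymbol_le ξ)
  simpa only [sub_sub_cancel] using
    hasSum_neg_multichoose_mul_pow hs₀ hs₁ (sub_nonneg.2 h₁) (sub_le_self 1 h₀)

theorem isUnimodalMultiplier_exp_neg_mul_latticeSymbol_rpow (hd : 1 ≤ d) (hs₀ : 0 < s)
    (hs₁ : s ≤ 1) {t : ℝ} (ht : 0 ≤ t) :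
    IsUnimodalMultiplier fun ξ : Fin d → ℝ => Real.exp (-t * latticeSymbol ξ ^ s) := by
  set T : ℝ := t * (4 * d) ^ s with hT
  refine .of_hasSum (a := fun n : ℕ => Real.exp (-T) * (T ^ n / n.factorial))
    (fun n => by positivity)
    (fun n => (isUnimodalMultiplier_one_sub_latticeSymbol_rpow hd hs₀ hs₁).pow n) fun ξ => ?_
  have hexponent : -t * latticeSymbol ξ ^ s =
      -T + T * (1 - (latticeSymbol ξ / (4 * d)) ^ s) := by
    rw [Real.div_rpow (latticeSymbol_nonneg ξ) (by positivity), hT]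
    field_simp
    ring
  have hseries := (NormedSpace.expSeries_div_hasSum_exp
    (T * (1 - (latticeSymbol ξ / (4 * d)) ^ s))).mul_left (Real.exp (-T))
  rw [← Real.exp_eq_exp_ℝ, ← Real.exp_add, ← hexponent] at hseries
  simpa only [mul_pow, mul_div_right_comm, mul_assoc] using hseries

theorem integral_exp_neg_mul_abs_rpow {p b : ℝ} (hp : 0 < p) (hb : 0 < b) :
    ∫ θ : ℝ, Real.exp (-b * |θ| ^ p) = 2 * (b ^ (-1 / p) * Real.Gamma (1 / p + 1)) := by
  rw [integral_comp_abs (f := fun θ => Real.exp (-b * θ ^ p)), integral_exp_neg_mul_rpow hp hb]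

theorem integrable_exp_neg_mul_abs_rpow {p b : ℝ} (hp : 0 < p) (hb : 0 < b) :
    Integrable fun θ : ℝ => Real.exp (-b * |θ| ^ p) := by
  refine .of_integral_ne_zero ?_
  rw [integral_exp_neg_mul_abs_rpow hp hb]
  have := Real.Gamma_pos_of_pos (s := 1 / p + 1) (by positivity)
  positivity

theorem rpow_le_latticeSymbol_single_rpow (hs : 0 ≤ s) (j : Fin d) {θ : ℝ} (hθ : |θ| ≤ Real.pi) :
    |2 / Real.pi * θ| ^ (2 * s) ≤ latticeSymbol (Pi.single j θ) ^ s := by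
  have hsin : |2 / Real.pi * θ| ≤ |2 * Real.sin (θ / 2)| := by
    have hhalf : |θ / 2| ≤ Real.pi / 2 := by
      rw [abs_div, abs_two]
      gcongr
    have h := Real.mul_abs_le_abs_sin hhalf
    rw [abs_div, abs_two] at h
    rw [abs_mul, abs_mul, abs_two, abs_of_pos (by positivity)]
    linarith
  rw [latticeSymbol_single, ← Real.rpow_mul (abs_nonneg _)]
  gcongr

theorem setIntegral_exp_neg_mul_latticeSymbol_single_le (hs : 0 < s) {t : ℝ} (ht : 0 < t)
    (j : Fin d) :
    ∫ θ in Set.Icc (-Real.pi) Real.pi, Real.exp (-t * latticeSymbol (Pi.single j θ) ^ s) ≤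
      Real.pi * (Real.Gamma (1 / (2 * s) + 1) * t ^ (-1 / (2 * s))) := by
  have hint : Integrable fun θ : ℝ => Real.exp (-t * |2 / Real.pi * θ| ^ (2 * s)) :=
    (integrable_exp_neg_mul_abs_rpow (by positivity) ht).comp_mul_left' (by positivity)
  calc ∫ θ in Set.Icc (-Real.pi) Real.pi, Real.exp (-t * latticeSymbol (Pi.single j θ) ^ s)
      ≤ ∫ θ in Set.Icc (-Real.pi) Real.pi, Real.exp (-t * |2 / Real.pi * θ| ^ (2 * s)) := by
        refine integral_mono_of_nonneg (.of_forall fun θ => (Real.exp_pos _).le)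
          hint.integrableOn ?_
        filter_upwards [ae_restrict_mem measurableSet_Icc] with θ hθ
        refine Real.exp_le_exp.2 (mul_le_mul_of_nonpos_left ?_ (neg_nonpos.2 ht.le))
        exact rpow_le_latticeSymbol_single_rpow hs.le j (abs_le.2 hθ)
    _ ≤ ∫ θ : ℝ, Real.exp (-t * |2 / Real.pi * θ| ^ (2 * s)) :=
        setIntegral_le_integral hint (.of_forall fun θ => (Real.exp_pos _).le)
    _ = Real.pi * (Real.Gamma (1 / (2 * s) + 1) * t ^ (-1 / (2 * s))) := by
        rw [Measure.integral_comp_mul_left (fun θ => Real.exp (-t * |θ| ^ (2 * s))),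
          integral_exp_neg_mul_abs_rpow (by positivity) ht, abs_of_pos (by positivity),
          smul_eq_mul]
        field_simp

end LatticeSymbol

theorem sum_abs_le_mul_latticeNorm {d : ℕ} (y : Fin d → ℤ) :
    ∑ j, |(y j : ℝ)| ≤ d * latticeNorm y := by
  have hcoord (j : Fin d) : |(y j : ℝ)| ≤ latticeNorm y :=
    Real.abs_le_sqrt (Finset.single_le_sum (f := fun i => (y i : ℝ) ^ 2)
      (fun i _ => sq_nonneg _) (Finset.mem_univ j))
  simpa using Finset.sum_le_card_nsmul Finset.univ _ _ fun j _ => hcoord j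

section LatticeHeatKernel

variable {d : ℕ} {s t : ℝ}

theorem exists_isSymmUnimodal_latticeHeatKernel_eq (hd : 1 ≤ d) (hs₀ : 0 < s) (hs₁ : s ≤ 1)
    (ht : 0 ≤ t) :
    ∃ g : (Fin d → ℤ) → ℝ, IsSymmUnimodal g ∧
      IsLatticeFourierPair (fun x => (g x : ℂ))
        (fun ξ => (Real.exp (-t * latticeSymbol ξ ^ s) : ℂ)) ∧
      latticeHeatKernel s t = fun x => (g x : ℂ) := by
  obtain ⟨g, hg, hgf⟩ :=
    (isUnimodalMultiplier_exp_neg_mul_latticeSymbol_rpow hd hs₀ hs₁ ht).isUnimodalSymbol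
  refine ⟨g, hg, hgf, funext fun x => ?_⟩
  rw [← hgf.setIntegral_eq x, Fintype.card_fin]
  rfl

theorem hasSum_norm_latticeHeatKernel (hd : 1 ≤ d) (hs₀ : 0 < s) (hs₁ : s ≤ 1) (ht : 0 ≤ t) :
    HasSum (fun x : Fin d → ℤ => ‖latticeHeatKernel s t x‖) 1 := by
  obtain ⟨g, hg, hgf, hker⟩ :=
    exists_isSymmUnimodal_latticeHeatKernel_eq (d := d) hd hs₀ hs₁ ht
  have hmass : HasSum g 1 := by
    simpa [latticeSymbol_zero, hs₀.ne'] using Complex.hasSum_ofReal.1 hgf.hasSum_apply_zero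
  simpa [hker, abs_of_nonneg (hg.nonneg _)] using hmass

theorem translationDist_latticeHeatKernel_single_le (hd : 1 ≤ d) (hs₀ : 0 < s) (hs₁ : s ≤ 1)
    (ht : 0 < t) (j : Fin d) :
    translationDist (latticeHeatKernel s t) (Pi.single j 1) ≤
      Real.Gamma (1 / (2 * s) + 1) * t ^ (-1 / (2 * s)) := by
  obtain ⟨g, hg, hgf, hker⟩ := exists_isSymmUnimodal_latticeHeatKernel_eq hd hs₀ hs₁ ht.le
  have hplane : HasSum (fun x => if x j = 0 then g x else 0) (1 / (2 * Real.pi) *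
      ∫ θ in Set.Icc (-Real.pi) Real.pi, Real.exp (-t * latticeSymbol (Pi.single j θ) ^ s)) := by
    rw [← Complex.hasSum_ofReal]
    simpa only [apply_ite Complex.ofReal, Complex.ofReal_zero, Complex.ofReal_mul,
      Complex.ofReal_div, Complex.ofReal_one, Complex.ofReal_ofNat, integral_complex_ofReal]
      using hgf.hasSum_hyperplane j
  have hreal : translationDist (latticeHeatKernel s t) (Pi.single j 1) =
      translationDist g (Pi.single j 1) := by
    simp only [translationDist, hker, ← Complex.ofReal_sub, Complex.norm_real]
  rw [hreal, hg.translationDist_single (Complex.summable_ofReal.1 hgf.summable) j hplane]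
  calc 2 * (1 / (2 * Real.pi) * ∫ θ in Set.Icc (-Real.pi) Real.pi,
          Real.exp (-t * latticeSymbol (Pi.single j θ) ^ s))
      ≤ 2 * (1 / (2 * Real.pi) *
          (Real.pi * (Real.Gamma (1 / (2 * s) + 1) * t ^ (-1 / (2 * s))))) := by
        gcongr
        exact setIntegral_exp_neg_mul_latticeSymbol_single_le hs₀ ht j
    _ = Real.Gamma (1 / (2 * s) + 1) * t ^ (-1 / (2 * s)) := by field_simp

theorem translationDist_latticeHeatKernel_le (hd : 1 ≤ d) (hs₀ : 0 < s) (hs₁ : s ≤ 1)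
    (ht : 0 < t) (y : Fin d → ℤ) :
    translationDist (latticeHeatKernel s t) y ≤
      d * Real.Gamma (1 / (2 * s) + 1) * (latticeNorm y * t ^ (-1 / (2 * s))) :=
  calc translationDist (latticeHeatKernel s t) y
      ≤ (∑ j, |(y j : ℝ)|) * (Real.Gamma (1 / (2 * s) + 1) * t ^ (-1 / (2 * s))) :=
        translationDist_le_sum_abs_mul (hasSum_norm_latticeHeatKernel hd hs₀ hs₁ ht.le).summable
          (translationDist_latticeHeatKernel_single_le hd hs₀ hs₁ ht) y
    _ ≤ d * latticeNorm y * (Real.Gamma (1 / (2 * s) + 1) * t ^ (-1 / (2 * s))) := by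
        gcongr
        exact sum_abs_le_mul_latticeNorm y
    _ = d * Real.Gamma (1 / (2 * s) + 1) * (latticeNorm y * t ^ (-1 / (2 * s))) := by ring

end LatticeHeatKernel

theorem proposition1p2 (d : ℕ) (hd : 1 ≤ d) (s : ℝ) (hs₀ : 0 < s) (hs₁ : s ≤ 1) :
    ∃ C : ℝ, 0 < C ∧ ∀ t : ℝ, 0 < t → ∀ y : Fin d → ℤ,
      Summable (fun x : Fin d → ℤ =>
        ‖latticeHeatKernel s t (x - y) - latticeHeatKernel s t x‖) ∧
      ∑' x : Fin d → ℤ, ‖latticeHeatKernel s t (x - y) - latticeHeatKernel s t x‖ ≤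
        C * min 1 (latticeNorm y * t ^ (-1 / (2 * s))) := by
  set K : ℝ := d * Real.Gamma (1 / (2 * s) + 1)
  refine ⟨max 2 K, by positivity, fun t ht y => ?_⟩
  have hmass : HasSum (fun x : Fin d → ℤ => ‖latticeHeatKernel s t x‖) 1 :=
    hasSum_norm_latticeHeatKernel hd hs₀ hs₁ ht.le
  refine ⟨summable_norm_translate_sub hmass.summable y, ?_⟩
  change translationDist (latticeHeatKernel s t) y ≤ _
  have hbounded : translationDist (latticeHeatKernel s t) y ≤ 2 := by
    simpa [hmass.tsum_eq] using translationDist_le_two_mul_tsum_norm hmass.summable y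
  have hdecay : translationDist (latticeHeatKernel s t) y ≤
      K * (latticeNorm y * t ^ (-1 / (2 * s))) :=
    translationDist_latticeHeatKernel_le hd hs₀ hs₁ ht y
  have hnonneg : 0 ≤ latticeNorm y * t ^ (-1 / (2 * s)) :=
    mul_nonneg (Real.sqrt_nonneg _) (Real.rpow_nonneg ht.le _)
  rw [mul_min_of_nonneg _ _ (by positivity), mul_one]
  exact le_min (hbounded.trans (le_max_left _ _))
    (hdecay.trans (mul_le_mul_of_nonneg_right (le_max_right _ _) hnonneg))
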